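/- Consider a two-player zero-sum perfect-information stochastic game on a finite arena: a finite set of states $S$ partitioned into the states controlled by Max and those controlled by Min, for every state $s$ a non-empty finite set $A(s)$ of available actions, and for every $s$ and $a\in A(s)$ a probability distribution $\delta(s,a)$ on $S$ according to which the next state is chosen. Let $r:S\to\mathbb R$ be a reward mapping. For a discount mapping $\lambda:S\to[0,1)$, the payoff (received by Max from Min) of an infinite play $s_0a_0s_1a_1\ldots$ is $$\varphi_\lambda(s_0a_0s_1a_1\ldots)=\sum_{i=0}^\infty \lambda(s_0)\cdots\lambda(s_{i-1})\,(1-\lambda(s_i))\,r(s_i).$$ Strategies may be randomized and may depend on the whole past. $\mathbb E_s^{\sigma,\tau}$ denotes expectation when the play starts in $s$ and Max and Min use $\sigma$ and $\tau$. The value of $s$ is $\mathrm{val}_s(\varphi_\lambda)=\sup_\sigma\inf_\tau\mathbb E_s^{\sigma,\tau}[\varphi_\lambda]=\inf_\tau\sup_\sigma\mathbb E_s^{\sigma,\tau}[\varphi_\lambda]$. A strategy $\sigma^\#$ of Max is optimal if $\inf_\tau\mathbb E_s^{\sigma^\#,\tau}[\varphi_\lambda]=\sup_\sigma\inf_\tau\mathbb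 E_s^{\sigma,\tau}[\varphi_\lambda]$ for every state $s$, and optimality for Min is defined dually. Let $(\lambda_t)$ be a rational discount parametrization: for each state $s$, $t\mapsto\lambda_t(s)$ is a quotient of two real polynomials in $t$, $\lambda_t(s)\in[0,1)$ for all $t\in[1-\varepsilon_0,1)$ for some $\varepsilon_0\in(0,1)$, and $\lim_{t\uparrow1}\lambda_t(s)=1$. Then there is $0<\varepsilon<1$, with $\lambda_t(s)\in[0,1)$ for all $t\in(1-\varepsilon,1)$ and all $s$, such that (1) for each state $s$, the value $\mathrm{val}_s(\varphi_{\lambda_t})$ exists for all $t\in(1-\varepsilon,1)$ and, on this interval, it is a rational function of $t$; (2) if a deterministic memoryless strategy (of Max or of Min) is optimal in the game with payoff $\varphi_{\lambda_t}$ for some $t\in(1-\varepsilon,1)$, then it is optimal in the game with payoff $\varphi_{\lambda_t}$ for all $t\in(1-\varepsilon,1)$. -/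

import Mathlib

open MeasureTheory ProbabilityTheory Set Filter Topology

/-- The two players. -/
inductive Player where
  | max
  | min

/-- A perfect-information stochastic arena with states `S` and actions `A`. The states are
partitioned by `owner` into the states controlled by `max` and those controlled by `min`. Only the
values `trans s a` with `a ∈ avail s` are relevant: strategies never choose other actions. -/
structure Arena (S A : Type*) where
  /-- the player controlling a state -/
  owner : S → Player
  /-- the actions available in a state -/
  avail : S → Set A
  avail_nonempty : ∀ s, (avail s).Nonempty
  /-- `trans s a s'` is the probability to go to `s'` when `a` is executed in `s` -/
  trans : S → A → PMF S

/-- One stage `s a` of a play: the current state and the action chosen there. -/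
@[ext]
structure Stage (S A : Type*) where
  state : S
  action : A

instance Stage.instMeasurableSpace (S A : Type*) : MeasurableSpace (Stage S A) := ⊤

instance Stage.instDiscreteMeasurableSpace (S A : Type*) :
    DiscreteMeasurableSpace (Stage S A) := ⟨fun _ => trivial⟩

instance Stage.instFinite (S A : Type*) [Finite S] [Finite A] : Finite (Stage S A) :=
  Finite.of_injective (fun m : Stage S A => (m.state, m.action)) fun m m' h => by
    cases m; cases m'; simp_all

/-- Infinite plays `s₀ a₀ s₁ a₁ …`, carrying the product σ-algebra, which is the one generated by
the cones of finite plays. -/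
abbrev Play (S A : Type*) := ℕ → Stage S A

namespace Arena

variable {S A : Type*}

/-- A strategy of player `i`: to each finite play `p s`, where `p` is the word of the stages before
the last state `s` and `s` is controlled by `i`, it assigns a probability distribution on actions
that is supported by the actions available in `s`. -/
structure Strategy (G : Arena S A) (i : Player) where
  toFun : List (Stage S A) → {s : S // G.owner s = i} → PMF A
  support_subset : ∀ p s, (toFun p s).support ⊆ G.avail s

namespace Strategy

variable {G : Arena S A} {i : Player}

/-- Every action that is chosen with positive probability is chosen with probability one. -/
def Deterministic (σ : G.Strategy i) : Prop :=
  ∀ p s a, 0 < σ.toFun p s a → σ.toFun p s a = 1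

/-- The choice depends only on the current state. -/
def Memoryless (σ : G.Strategy i) : Prop :=
  ∀ p s, σ.toFun p s = σ.toFun [] s

end Strategy

/-- The distribution of the action chosen after the finite play `p s`, by the player who
controls `s`. -/
noncomputable def choice (G : Arena S A) (σ : G.Strategy .max) (τ : G.Strategy .min)
    (p : List (Stage S A)) (s : S) : PMF A :=
  match h : G.owner s with
  | .max => σ.toFun p ⟨s, h⟩
  | .min => τ.toFun p ⟨s, h⟩

/-- The distribution of the stage `s a` when the current state is `s` and the stages before it
form the word `p`. -/
noncomputable def stageAt (G : Arena S A) (σ : G.Strategy .max) (τ : G.Strategy .min)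
    (p : List (Stage S A)) (s : S) : PMF (Stage S A) :=
  (G.choice σ τ p s).map fun a => ⟨s, a⟩

/-- The distribution of stage `n + 1`, given the stages `0, …, n`: the next state is drawn from the
transition mapping, the next action by the player who controls that state. -/
noncomputable def nextStage (G : Arena S A) (σ : G.Strategy .max) (τ : G.Strategy .min)
    (n : ℕ) (x : (Finset.Iic n) → Stage S A) : PMF (Stage S A) :=
  (G.trans (x ⟨n, by simp⟩).state (x ⟨n, by simp⟩).action).bind fun s' =>
    G.stageAt σ τ
      (List.ofFn fun k : Fin (n + 1) => x ⟨k, Finset.mem_Iic.2 (Nat.lt_succ_iff.1 k.2)⟩) s'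

section Measure

variable [Finite S] [Finite A]

/-- `nextStage` as a Markov kernel (all maps from the finite set of histories of a given length are
measurable). -/
noncomputable def stepKernel (G : Arena S A) (σ : G.Strategy .max) (τ : G.Strategy .min)
    (n : ℕ) : Kernel ((Finset.Iic n) → Stage S A) (Stage S A) :=
  Kernel.ofFunOfCountable fun x => (G.nextStage σ τ n x).toMeasure

instance (G : Arena S A) (σ : G.Strategy .max) (τ : G.Strategy .min) (n : ℕ) :
    IsMarkovKernel (G.stepKernel σ τ n) :=
  ⟨fun x => inferInstanceAs (IsProbabilityMeasure (G.nextStage σ τ n x).toMeasure)⟩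

/-- The probability measure on infinite plays induced by the strategies `σ`, `τ` and the initial
state `s` (Ionescu Tulcea). -/
noncomputable def playMeasure (G : Arena S A) (σ : G.Strategy .max) (τ : G.Strategy .min)
    (s : S) : Measure (Play S A) :=
  Kernel.trajMeasure (X := fun _ => Stage S A) (G.stageAt σ τ [] s).toMeasure (G.stepKernel σ τ)

/-- The expected payoff from the initial state `s`. -/
noncomputable def expect (G : Arena S A) (u : Play S A → ℝ) (σ : G.Strategy .max)
    (τ : G.Strategy .min) (s : S) : ℝ :=
  ∫ ω, u ω ∂(G.playMeasure σ τ s)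

/-- `sup_σ inf_τ` of the expected payoff. -/
noncomputable def lowerVal (G : Arena S A) (u : Play S A → ℝ) (s : S) : ℝ :=
  ⨆ σ : G.Strategy .max, ⨅ τ : G.Strategy .min, G.expect u σ τ s

/-- `inf_τ sup_σ` of the expected payoff. -/
noncomputable def upperVal (G : Arena S A) (u : Play S A → ℝ) (s : S) : ℝ :=
  ⨅ τ : G.Strategy .min, ⨆ σ : G.Strategy .max, G.expect u σ τ s

/-- In the game with payoff `u` (bounded and measurable), the state `s` has the value `v`. -/
def HasValue (G : Arena S A) (u : Play S A → ℝ) (s : S) (v : ℝ) : Prop :=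
  G.lowerVal u s = v ∧ G.upperVal u s = v

/-- Optimality of a strategy of `max`, for every initial state. -/
def OptimalMax (G : Arena S A) (u : Play S A → ℝ) (σ : G.Strategy .max) : Prop :=
  ∀ s, ⨅ τ : G.Strategy .min, G.expect u σ τ s = G.lowerVal u s

/-- Optimality of a strategy of `min`, for every initial state. -/
def OptimalMin (G : Arena S A) (u : Play S A → ℝ) (τ : G.Strategy .min) : Prop :=
  ∀ s, ⨆ σ : G.Strategy .max, G.expect u σ τ s = G.upperVal u s

end Measure

end Arena

/-- The discounted payoff `∑ᵢ l(s₀)⋯l(sᵢ₋₁)(1 - l(sᵢ)) r(sᵢ)` with discount mapping `l`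
and reward mapping `r`. -/
noncomputable def discountedPayoff {S A : Type*} (l r : S → ℝ) (ω : Play S A) : ℝ :=
  ∑' i : ℕ, (∏ j ∈ Finset.range i, l (ω j).state) * (1 - l (ω i).state) * r (ω i).state

/-- `l t s` is the discount factor of the state `s` for the parameter `t`: for each `s`, it is a
quotient of two polynomials in `t` (where the denominator does not vanish), it lies in `[0,1)` on
some `[1 - ε, 1)`, and it tends to `1` as `t` increases to `1`. -/
structure IsRationalDiscountParam {S : Type*} (l : ℝ → S → ℝ) : Prop where
  rational : ∀ s, ∃ p q : Polynomial ℝ, q ≠ 0 ∧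
    ∀ t, q.eval t ≠ 0 → l t s = p.eval t / q.eval t
  mem_Ico : ∀ s, ∃ ε : ℝ, 0 < ε ∧ ε < 1 ∧ ∀ t ∈ Ico (1 - ε) 1, l t s ∈ Ico (0 : ℝ) 1
  tendsto : ∀ s, Tendsto (fun t => l t s) (𝓝[<] 1) (𝓝 1)

namespace PMF

variable {α β : Type*}

/-- The expectation of a real function under a probability mass function. -/
noncomputable def mean (p : PMF α) (f : α → ℝ) : ℝ :=
  ∑' a, (p a).toReal * f a

theorem mean_eq_sum [Fintype α] (p : PMF α) (f : α → ℝ) :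
    p.mean f = ∑ a, (p a).toReal * f a :=
  tsum_fintype _

theorem sum_toReal [Fintype α] (p : PMF α) : ∑ a, (p a).toReal = 1 := by
  rw [← ENNReal.toReal_sum fun a _ => p.apply_ne_top a, ← tsum_fintype (L := .unconditional _),
    p.tsum_coe, ENNReal.toReal_one]

variable [Finite α] [Finite β]

theorem mean_eq_integral [MeasurableSpace α] [MeasurableSingletonClass α] (p : PMF α)
    (f : α → ℝ) : p.mean f = ∫ a, f a ∂p.toMeasure := by
  cases nonempty_fintype α
  rw [integral_eq_sum, mean_eq_sum]
  rfl

theorem mean_const (p : PMF α) (c : ℝ) : (p.mean fun _ => c) = c := by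
  cases nonempty_fintype α
  rw [mean_eq_sum, ← Finset.sum_mul, sum_toReal, one_mul]

theorem mean_sub (p : PMF α) (f g : α → ℝ) : (p.mean fun a => f a - g a) = p.mean f - p.mean g := by
  cases nonempty_fintype α
  simp_rw [mean_eq_sum, mul_sub, Finset.sum_sub_distrib]

theorem mean_neg (p : PMF α) (f : α → ℝ) : (p.mean fun a => -f a) = -p.mean f := by
  cases nonempty_fintype α
  simp_rw [mean_eq_sum, mul_neg, Finset.sum_neg_distrib]

theorem mean_mono {p : PMF α} {f g : α → ℝ} (h : ∀ a ∈ p.support, f a ≤ g a) :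
    p.mean f ≤ p.mean g := by
  cases nonempty_fintype α
  simp_rw [mean_eq_sum]
  refine Finset.sum_le_sum fun a _ => ?_
  by_cases ha : p a = 0
  · simp [ha]
  · exact mul_le_mul_of_nonneg_left (h a ((p.mem_support_iff a).2 ha)) ENNReal.toReal_nonneg

theorem mean_le {p : PMF α} {f : α → ℝ} {c : ℝ} (h : ∀ a ∈ p.support, f a ≤ c) :
    p.mean f ≤ c :=
  (mean_mono h).trans_eq (p.mean_const c)

theorem le_mean {p : PMF α} {f : α → ℝ} {c : ℝ} (h : ∀ a ∈ p.support, c ≤ f a) :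
    c ≤ p.mean f :=
  (p.mean_const c).symm.trans_le (mean_mono h)

theorem eq_of_le_of_le_mean {p : PMF α} {f : α → ℝ} {c : ℝ} (h : ∀ a ∈ p.support, f a ≤ c)
    (hc : c ≤ p.mean f) {a : α} (ha : a ∈ p.support) : f a = c := by
  cases nonempty_fintype α
  by_contra hne
  have hlt : p.mean f < p.mean fun _ => c := by
    simp_rw [mean_eq_sum]
    refine Finset.sum_lt_sum (fun b _ => ?_) ⟨a, Finset.mem_univ a, ?_⟩
    · by_cases hb : p b = 0
      · simp [hb]
      · exact mul_le_mul_of_nonneg_left (h b ((p.mem_support_iff b).2 hb)) ENNReal.toReal_nonneg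
    · exact mul_lt_mul_of_pos_left (lt_of_le_of_ne (h a ha) hne)
        (ENNReal.toReal_pos ((p.mem_support_iff a).1 ha) (p.apply_ne_top a))
  rw [mean_const] at hlt
  exact hlt.not_ge hc

theorem eq_of_ge_of_mean_le {p : PMF α} {f : α → ℝ} {c : ℝ} (h : ∀ a ∈ p.support, c ≤ f a)
    (hc : p.mean f ≤ c) {a : α} (ha : a ∈ p.support) : f a = c :=
  neg_injective <| eq_of_le_of_le_mean (f := fun b => -f b) (fun b hb => neg_le_neg (h b hb))
    (by rw [mean_neg]; exact neg_le_neg hc) ha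

theorem mean_nonneg_of_const_mul {p : PMF α} {f : α → ℝ} {b c : ℝ} (hc : 0 ≤ c)
    (h : b ≤ p.mean f) : 0 ≤ p.mean fun a => c * (f a - b) := by
  cases nonempty_fintype α
  have : (p.mean fun a => c * (f a - b)) = c * (p.mean fun a => f a - b) := by
    simp_rw [mean_eq_sum, Finset.mul_sum, mul_left_comm]
  rw [this, mean_sub, mean_const]
  exact mul_nonneg hc (sub_nonneg.2 h)

theorem mean_bind (p : PMF α) (q : α → PMF β) (f : β → ℝ) :
    (p.bind q).mean f = p.mean fun a => (q a).mean f := by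
  cases nonempty_fintype α
  cases nonempty_fintype β
  simp_rw [mean_eq_sum, bind_apply, tsum_fintype, Finset.mul_sum]
  rw [Finset.sum_comm]
  refine Finset.sum_congr rfl fun b _ => ?_
  rw [ENNReal.toReal_sum fun a _ => ENNReal.mul_ne_top (p.apply_ne_top a) ((q a).apply_ne_top b),
    Finset.sum_mul]
  simp_rw [ENNReal.toReal_mul, mul_assoc]

theorem mean_pure (a : α) (f : α → ℝ) : (pure a : PMF α).mean f = f a := by
  refine le_antisymm (mean_le fun b hb => ?_) (le_mean fun b hb => ?_) <;> simp_all

theorem mean_map (p : PMF α) (g : α → β) (f : β → ℝ) :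
    (p.map g).mean f = p.mean fun a => f (g a) := by
  simp only [← bind_pure_comp, mean_bind, Function.comp_apply, mean_pure]

end PMF

namespace Arena

variable {S A : Type*}

/-- The expected value of the one-shot game with stage payoff `(1 - l s) r s` in which the payoff
`v` is received, discounted by `l s`, in the next state. -/
noncomputable def oneStep (G : Arena S A) (l r v : S → ℝ) (s : S) (a : A) : ℝ :=
  (1 - l s) * r s + l s * (G.trans s a).mean v

/-- The payoff collected in the first `n` stages of a play, followed by the discounted terminal
payoff `w`. -/
noncomputable def truncatedPayoff (l r : S → ℝ) (w : Stage S A → ℝ) (n : ℕ) (ω : Play S A) : ℝ :=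
  ∑ i ∈ Finset.range n,
    (∏ j ∈ Finset.range i, l (ω j).state) * (1 - l (ω i).state) * r (ω i).state +
  (∏ j ∈ Finset.range n, l (ω j).state) * w (ω n)

section Payoff

variable {l r : S → ℝ}

theorem exists_lt_one_forall_le [Finite S] (hl : ∀ s, l s ∈ Ico (0 : ℝ) 1) :
    ∃ c : ℝ, 0 ≤ c ∧ c < 1 ∧ ∀ s, l s ≤ c := by
  cases isEmpty_or_nonempty S
  · exact ⟨0, le_rfl, one_pos, isEmptyElim⟩
  · obtain ⟨s, hs⟩ := Finite.exists_max l
    exact ⟨l s, (hl s).1, (hl s).2, hs⟩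

theorem exists_forall_abs_le {α : Type*} [Finite α] (f : α → ℝ) : ∃ K : ℝ, 0 ≤ K ∧ ∀ a, |f a| ≤ K := by
  cases isEmpty_or_nonempty α
  · exact ⟨0, le_rfl, isEmptyElim⟩
  · obtain ⟨a, ha⟩ := Finite.exists_max fun a => |f a|
    exact ⟨|f a|, abs_nonneg _, ha⟩

theorem prod_discount_mem {c : ℝ} (hl : ∀ s, l s ∈ Ico (0 : ℝ) 1) (hc : ∀ s, l s ≤ c)
    (ω : Play S A) (n : ℕ) :
    (∏ j ∈ Finset.range n, l (ω j).state) ∈ Icc 0 (c ^ n) := by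
  refine ⟨Finset.prod_nonneg fun j _ => (hl _).1, ?_⟩
  simpa using Finset.prod_le_prod (s := Finset.range n) (f := fun j => l (ω j).state)
    (g := fun _ => c) (fun j _ => (hl _).1) fun j _ => hc _

theorem abs_payoff_term_le {c K : ℝ} (hl : ∀ s, l s ∈ Ico (0 : ℝ) 1) (hc : ∀ s, l s ≤ c)
    (hK : ∀ s, |r s| ≤ K) (ω : Play S A) (i : ℕ) :
    |(∏ j ∈ Finset.range i, l (ω j).state) * (1 - l (ω i).state) * r (ω i).state| ≤
      c ^ i * K := by
  obtain ⟨h0, h1⟩ := prod_discount_mem hl hc ω i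
  obtain ⟨h2, h3⟩ := hl (ω i).state
  rw [abs_mul, abs_mul, abs_of_nonneg h0, abs_of_nonneg (by linarith : (0:ℝ) ≤ 1 - l (ω i).state)]
  refine mul_le_mul ?_ (hK _) (abs_nonneg _) (h0.trans h1)
  exact (mul_le_of_le_one_right h0 (by linarith)).trans h1

theorem measurable_truncatedPayoff (w : Stage S A → ℝ) (n : ℕ) :
    Measurable (truncatedPayoff l r w n) := by
  have h (f : Stage S A → ℝ) (i : ℕ) : Measurable fun ω : Play S A => f (ω i) :=
    (Measurable.of_discrete (f := f)).comp (measurable_pi_apply i)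
  refine (Finset.measurable_fun_sum _ fun i _ => ?_).add ((Finset.measurable_fun_prod _ fun j _ => ?_).mul ?_)
  · exact ((Finset.measurable_fun_prod _ fun j _ => h (fun m => l m.state) j).mul
      (h (fun m => 1 - l m.state) i)).mul (h (fun m => r m.state) i)
  · exact h (fun m => l m.state) j
  · exact h w n

variable [Finite S]

theorem summable_payoff (hl : ∀ s, l s ∈ Ico (0 : ℝ) 1) (ω : Play S A) :
    Summable fun i =>
      (∏ j ∈ Finset.range i, l (ω j).state) * (1 - l (ω i).state) * r (ω i).state := by
  obtain ⟨c, hc0, hc1, hc⟩ := exists_lt_one_forall_le hl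
  obtain ⟨K, -, hK⟩ := exists_forall_abs_le r
  exact .of_norm_bounded ((summable_geometric_of_lt_one hc0 hc1).mul_right K)
    (abs_payoff_term_le hl hc hK ω)

theorem exists_forall_abs_discountedPayoff_le (hl : ∀ s, l s ∈ Ico (0 : ℝ) 1) :
    ∃ K, ∀ ω : Play S A, |discountedPayoff l r ω| ≤ K := by
  obtain ⟨c, hc0, hc1, hc⟩ := exists_lt_one_forall_le hl
  obtain ⟨K, -, hK⟩ := exists_forall_abs_le r
  exact ⟨∑' n, c ^ n * K, fun ω => (Real.norm_eq_abs _).symm.trans_le <| tsum_of_norm_bounded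
    ((summable_geometric_of_lt_one hc0 hc1).mul_right K).hasSum (abs_payoff_term_le hl hc hK ω)⟩

variable [Finite A]

theorem tendsto_truncatedPayoff (hl : ∀ s, l s ∈ Ico (0 : ℝ) 1) (w : Stage S A → ℝ)
    (ω : Play S A) :
    Tendsto (fun n => truncatedPayoff l r w n ω) atTop (𝓝 (discountedPayoff l r ω)) := by
  obtain ⟨c, hc0, hc1, hc⟩ := exists_lt_one_forall_le hl
  obtain ⟨K, -, hK⟩ := exists_forall_abs_le w
  have h := (summable_payoff (r := r) hl ω).hasSum.tendsto_sum_nat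
  have h' : Tendsto (fun n => (∏ j ∈ Finset.range n, l (ω j).state) * w (ω n)) atTop (𝓝 0) := by
    refine squeeze_zero_norm (a := fun n => c ^ n * K) (fun n => ?_) ?_
    · obtain ⟨h0, h1⟩ := prod_discount_mem hl hc ω n
      rw [Real.norm_eq_abs, abs_mul, abs_of_nonneg h0]
      exact mul_le_mul h1 (hK _) (abs_nonneg _) (h0.trans h1)
    · simpa using (tendsto_pow_atTop_nhds_zero_of_lt_one hc0 hc1).mul_const K
  simpa [truncatedPayoff, discountedPayoff] using h.add h'

theorem exists_forall_abs_truncatedPayoff_le (hl : ∀ s, l s ∈ Ico (0 : ℝ) 1)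
    (w : Stage S A → ℝ) : ∃ K, ∀ n ω, |truncatedPayoff l r w n ω| ≤ K := by
  obtain ⟨c, hc0, hc1, hc⟩ := exists_lt_one_forall_le hl
  obtain ⟨K, hK0, hK⟩ := exists_forall_abs_le r
  obtain ⟨K', hK0', hK'⟩ := exists_forall_abs_le w
  refine ⟨∑' n, c ^ n * K + K', fun n ω => (abs_add_le _ _).trans (add_le_add ?_ ?_)⟩
  · refine (Finset.abs_sum_le_sum_abs _ _).trans
      ((Finset.sum_le_sum fun i _ => abs_payoff_term_le hl hc hK ω i).trans ?_)
    exact ((summable_geometric_of_lt_one hc0 hc1).mul_right K).sum_le_tsum _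
      fun i _ => mul_nonneg (pow_nonneg hc0 i) hK0
  · obtain ⟨h0, h1⟩ := prod_discount_mem hl hc ω n
    rw [abs_mul, abs_of_nonneg h0]
    exact (mul_le_of_le_one_left (abs_nonneg _) (h1.trans (pow_le_one₀ hc0 hc1.le))).trans (hK' _)

end Payoff

section Expect

variable [Finite S] [Finite A] (G : Arena S A) (σ : G.Strategy .max) (τ : G.Strategy .min)

instance isProbabilityMeasure_playMeasure (s : S) : IsProbabilityMeasure (G.playMeasure σ τ s) := by
  unfold playMeasure
  infer_instance

theorem integral_stage_zero (s : S) (f : Stage S A → ℝ) :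
    ∫ ω, f (ω 0) ∂G.playMeasure σ τ s = (G.choice σ τ [] s).mean fun a => f ⟨s, a⟩ := by
  have h : (G.playMeasure σ τ s).map (fun ω => ω 0) = (G.stageAt σ τ [] s).toMeasure := by
    have h0 : (fun ω : Play S A => ω 0) =
        (MeasurableEquiv.piUnique fun _ : Finset.Iic 0 => Stage S A) ∘ Preorder.frestrictLe 0 := rfl
    rw [h0, ← Measure.map_map (by fun_prop) (by fun_prop), playMeasure, Kernel.trajMeasure,
      Measure.map_comp _ _ (by fun_prop), Kernel.traj_map_frestrictLe, Kernel.partialTraj_self,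
      Measure.id_comp, Measure.map_map (by fun_prop) (by fun_prop)]
    exact Measure.map_id
  rw [← integral_map (μ := G.playMeasure σ τ s) (measurable_pi_apply 0).aemeasurable
    (Measurable.of_discrete (f := f)).aestronglyMeasurable, h, ← PMF.mean_eq_integral, stageAt,
    PMF.mean_map]

theorem integral_stage_succ_nonneg (s : S) (n : ℕ)
    (g : ((i : Finset.Iic n) → Stage S A) × Stage S A → ℝ)
    (hg : ∀ x, 0 ≤ (G.nextStage σ τ n x).mean fun m => g (x, m)) :
    0 ≤ ∫ ω, g (Preorder.frestrictLe n ω, ω (n + 1)) ∂G.playMeasure σ τ s := by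
  rw [← integral_map (μ := G.playMeasure σ τ s)
    (φ := fun ω => (Preorder.frestrictLe n ω, ω (n + 1))) (f := g) (by fun_prop)
    (Measurable.of_discrete (f := g)).aestronglyMeasurable, playMeasure,
    ← Kernel.map_frestrictLe_trajMeasure_compProd_eq_map_trajMeasure,
    Measure.integral_compProd (.of_finite)]
  refine integral_nonneg fun x => ?_
  have h := hg x
  rwa [PMF.mean_eq_integral] at h

variable {G σ τ} {l r v : S → ℝ}

theorem integrable_truncatedPayoff (hl : ∀ s, l s ∈ Ico (0 : ℝ) 1) (w : Stage S A → ℝ) (n : ℕ)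
    (s : S) : Integrable (truncatedPayoff l r w n) (G.playMeasure σ τ s) := by
  obtain ⟨K, hK⟩ := exists_forall_abs_truncatedPayoff_le (r := r) hl w
  exact .of_bound (measurable_truncatedPayoff w n).aestronglyMeasurable K (ae_of_all _ (hK n))

theorem exists_forall_abs_expect_le (hl : ∀ s, l s ∈ Ico (0 : ℝ) 1) :
    ∃ K, ∀ (σ : G.Strategy .max) (τ : G.Strategy .min) (s : S),
      |G.expect (discountedPayoff l r) σ τ s| ≤ K := by
  obtain ⟨K, hK⟩ := exists_forall_abs_discountedPayoff_le (A := A) (r := r) hl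
  refine ⟨K, fun σ τ s => ?_⟩
  simpa [expect] using norm_integral_le_of_norm_le_const (μ := G.playMeasure σ τ s)
    (f := discountedPayoff l r) (ae_of_all _ hK)

theorem tendsto_integral_truncatedPayoff (hl : ∀ s, l s ∈ Ico (0 : ℝ) 1) (w : Stage S A → ℝ)
    (s : S) :
    Tendsto (fun n => ∫ ω, truncatedPayoff l r w n ω ∂G.playMeasure σ τ s) atTop
      (𝓝 (G.expect (discountedPayoff l r) σ τ s)) := by
  obtain ⟨K, hK⟩ := exists_forall_abs_truncatedPayoff_le (r := r) hl w
  exact tendsto_integral_of_dominated_convergence (fun _ => K)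
    (fun n => (measurable_truncatedPayoff w n).aestronglyMeasurable) (integrable_const K)
    (fun n => ae_of_all _ (hK n)) (ae_of_all _ (tendsto_truncatedPayoff hl w))

/-- If the strategies guarantee in each one-shot game with terminal payoff `v` at least `v`, then
the expected payoff is at least what they yield in the first of these games. -/
theorem mean_oneStep_le_expect (hl : ∀ s, l s ∈ Ico (0 : ℝ) 1)
    (h : ∀ p s, v s ≤ (G.choice σ τ p s).mean (G.oneStep l r v s)) (s : S) :
    (G.choice σ τ [] s).mean (G.oneStep l r v s) ≤ G.expect (discountedPayoff l r) σ τ s := by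
  set w : Stage S A → ℝ := fun m => G.oneStep l r v m.state m.action with hw
  have hmono : Monotone fun n => ∫ ω, truncatedPayoff l r w n ω ∂G.playMeasure σ τ s := by
    refine monotone_nat_of_le_succ fun n => ?_
    rw [← sub_nonneg, ← integral_sub (integrable_truncatedPayoff hl w _ s)
      (integrable_truncatedPayoff hl w _ s)]
    let g : ((i : Finset.Iic n) → Stage S A) × Stage S A → ℝ := fun x =>
      (∏ j : Fin (n + 1), l (x.1 ⟨j, Finset.mem_Iic.2 (Nat.lt_succ_iff.1 j.2)⟩).state) *
        (w x.2 - (G.trans (x.1 ⟨n, by simp⟩).state (x.1 ⟨n, by simp⟩).action).mean v)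
    have hg : ∀ ω : Play S A, truncatedPayoff l r w (n + 1) ω - truncatedPayoff l r w n ω =
        g (Preorder.frestrictLe n ω, ω (n + 1)) := by
      intro ω
      have hprod : (∏ j : Fin (n + 1), l (ω j).state) =
          (∏ j ∈ Finset.range n, l (ω j).state) * l (ω n).state := by
        rw [Fin.prod_univ_eq_prod_range (fun j => l (ω j).state) (n + 1), Finset.prod_range_succ]
      simp only [g, Preorder.frestrictLe_apply, hprod, truncatedPayoff, Finset.sum_range_succ,
        Finset.prod_range_succ]
      rw [show w (ω n) = (1 - l (ω n).state) * r (ω n).state +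
        l (ω n).state * (G.trans (ω n).state (ω n).action).mean v from rfl]
      ring
    simp_rw [hg]
    refine G.integral_stage_succ_nonneg σ τ s n g fun x => ?_
    have hΛ : 0 ≤ ∏ j : Fin (n + 1),
        l (x ⟨j, Finset.mem_Iic.2 (Nat.lt_succ_iff.1 j.2)⟩).state :=
      Finset.prod_nonneg fun j _ => (hl _).1
    suffices (G.trans (x ⟨n, by simp⟩).state (x ⟨n, by simp⟩).action).mean v ≤
      (G.nextStage σ τ n x).mean w from PMF.mean_nonneg_of_const_mul hΛ this
    rw [nextStage, PMF.mean_bind]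
    refine PMF.mean_mono fun s' _ => ?_
    rw [stageAt, PMF.mean_map]
    exact h _ s'
  have h0 := hmono.ge_of_tendsto (tendsto_integral_truncatedPayoff hl w s) 0
  rwa [show truncatedPayoff l r w 0 = fun ω => w (ω 0) by ext; simp [truncatedPayoff],
    integral_stage_zero] at h0

theorem expect_le_mean_oneStep (hl : ∀ s, l s ∈ Ico (0 : ℝ) 1)
    (h : ∀ p s, (G.choice σ τ p s).mean (G.oneStep l r v s) ≤ v s) (s : S) :
    G.expect (discountedPayoff l r) σ τ s ≤ (G.choice σ τ [] s).mean (G.oneStep l r v s) := by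
  have hstep (s : S) : G.oneStep l (-r) (fun s => -v s) s = fun a => -G.oneStep l r v s a := by
    ext a
    simp only [oneStep, PMF.mean_neg, Pi.neg_apply]
    ring
  have hpay : discountedPayoff (A := A) l (-r) = fun ω => -discountedPayoff l r ω := by
    ext ω
    simp only [discountedPayoff, Pi.neg_apply, mul_neg, tsum_neg]
  have := mean_oneStep_le_expect (G := G) (σ := σ) (τ := τ) (r := -r) (v := fun s => -v s) hl
    (fun p s => by rw [hstep, PMF.mean_neg]; exact neg_le_neg (h p s)) s
  rw [hstep, PMF.mean_neg, hpay, expect, integral_neg] at this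
  exact neg_le_neg_iff.1 this

end Expect

end Arena

/-- Near `1` from the left, `g` coincides with a quotient of two polynomials. -/
def EventuallyRational (g : ℝ → ℝ) : Prop :=
  ∃ p q : Polynomial ℝ, q ≠ 0 ∧ ∀ᶠ t in 𝓝[<] (1 : ℝ), g t = p.eval t / q.eval t

theorem Polynomial.eventually_eval_ne_zero {q : Polynomial ℝ} (hq : q ≠ 0) (a : ℝ) :
    ∀ᶠ t in 𝓝[<] a, q.eval t ≠ 0 := by
  have hfin : ({t | q.IsRoot t} \ {a}).Finite := (Polynomial.finite_setOfPred_isRoot hq).sdiff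
  have h : ∀ᶠ t in 𝓝[<] a, t ∉ {t | q.IsRoot t} \ {a} :=
    nhdsWithin_le_nhds (hfin.isClosed.isOpen_compl.mem_nhds fun h => h.2 rfl)
  filter_upwards [h, self_mem_nhdsWithin] with t ht hta h0
  exact ht ⟨h0, ne_of_lt hta⟩

theorem Polynomial.exists_eventually_sign_eq (p : Polynomial ℝ) (a : ℝ) :
    ∃ c : SignType, ∀ᶠ t in 𝓝[<] a, SignType.sign (p.eval t) = c := by
  by_cases hp : p = 0
  · exact ⟨0, by simp [hp]⟩
  obtain ⟨h, hph, hdvd⟩ := p.exists_eq_pow_rootMultiplicity_mul_and_not_dvd hp a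
  have hne : h.eval a ≠ 0 := fun h0 => hdvd (Polynomial.dvd_iff_isRoot.2 h0)
  refine ⟨(-1) ^ p.rootMultiplicity a * SignType.sign (h.eval a), ?_⟩
  have hh : ∀ᶠ t in 𝓝[<] a, SignType.sign (h.eval t) = SignType.sign (h.eval a) := by
    have hcont : Tendsto (fun t => SignType.sign (h.eval t)) (𝓝 a) (𝓝 (SignType.sign (h.eval a))) :=
      (continuousAt_sign_of_ne_zero hne).tendsto.comp h.continuous.continuousAt
    rw [nhds_discrete SignType] at hcont
    exact nhdsWithin_le_nhds (tendsto_pure.1 hcont)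
  filter_upwards [hh, self_mem_nhdsWithin] with t ht hta
  have hsign : SignType.sign (t - a) = -1 := sign_neg (sub_neg.2 (mem_Iio.1 hta))
  nth_rewrite 1 [hph]
  rw [Polynomial.eval_mul, Polynomial.eval_pow, sign_mul, sign_pow, ht, Polynomial.eval_sub,
    Polynomial.eval_X, Polynomial.eval_C, hsign]

namespace EventuallyRational

theorem const (c : ℝ) : EventuallyRational fun _ => c :=
  ⟨.C c, 1, one_ne_zero, by simp⟩

variable {f g : ℝ → ℝ}

theorem congr (hf : EventuallyRational f) (h : ∀ᶠ t in 𝓝[<] (1 : ℝ), g t = f t) :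
    EventuallyRational g := by
  obtain ⟨p, q, hq, hpq⟩ := hf
  exact ⟨p, q, hq, by filter_upwards [h, hpq] with t h1 h2 using h1.trans h2⟩

theorem add (hf : EventuallyRational f) (hg : EventuallyRational g) :
    EventuallyRational fun t => f t + g t := by
  obtain ⟨p, q, hq, hpq⟩ := hf
  obtain ⟨p', q', hq', hpq'⟩ := hg
  refine ⟨p * q' + q * p', q * q', mul_ne_zero hq hq', ?_⟩
  filter_upwards [hpq, hpq', Polynomial.eventually_eval_ne_zero hq 1,
    Polynomial.eventually_eval_ne_zero hq' 1] with t h1 h2 h3 h4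
  simp [h1, h2, div_add_div _ _ h3 h4]

theorem mul (hf : EventuallyRational f) (hg : EventuallyRational g) :
    EventuallyRational fun t => f t * g t := by
  obtain ⟨p, q, hq, hpq⟩ := hf
  obtain ⟨p', q', hq', hpq'⟩ := hg
  refine ⟨p * p', q * q', mul_ne_zero hq hq', ?_⟩
  filter_upwards [hpq, hpq'] with t h1 h2
  simp [h1, h2, div_mul_div_comm]

theorem sub (hf : EventuallyRational f) (hg : EventuallyRational g) :
    EventuallyRational fun t => f t - g t :=
  (hf.add ((const (-1)).mul hg)).congr (.of_forall fun t => by ring)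

theorem inv (hf : EventuallyRational f) : EventuallyRational fun t => (f t)⁻¹ := by
  obtain ⟨p, q, hq, hpq⟩ := hf
  by_cases hp : p = 0
  · exact (const 0).congr (hpq.mono fun t ht => by simp [ht, hp])
  · exact ⟨q, p, hp, hpq.mono fun t ht => by simp [ht]⟩

theorem sum {ι : Type*} (s : Finset ι) {f : ι → ℝ → ℝ} (hf : ∀ i ∈ s, EventuallyRational (f i)) :
    EventuallyRational fun t => ∑ i ∈ s, f i t := by
  classical
  induction s using Finset.induction_on with
  | empty => simpa using const 0
  | insert i s hi ih =>
    simp_rw [Finset.sum_insert hi]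
    exact (hf i (by simp)).add (ih fun j hj => hf j (by simp [hj]))

theorem prod {ι : Type*} (s : Finset ι) {f : ι → ℝ → ℝ} (hf : ∀ i ∈ s, EventuallyRational (f i)) :
    EventuallyRational fun t => ∏ i ∈ s, f i t := by
  classical
  induction s using Finset.induction_on with
  | empty => simpa using const 1
  | insert i s hi ih =>
    simp_rw [Finset.prod_insert hi]
    exact (hf i (by simp)).mul (ih fun j hj => hf j (by simp [hj]))

theorem det {n : Type*} [Fintype n] [DecidableEq n] {M : ℝ → Matrix n n ℝ}
    (hM : ∀ i j, EventuallyRational fun t => M t i j) : EventuallyRational fun t => (M t).det := by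
  simp_rw [Matrix.det_apply']
  exact sum _ fun π _ => (const _).mul (prod _ fun i _ => hM _ _)

theorem inv_mulVec {n : Type*} [Fintype n] [DecidableEq n] {M : ℝ → Matrix n n ℝ} {b : ℝ → n → ℝ}
    (hM : ∀ i j, EventuallyRational fun t => M t i j) (hb : ∀ i, EventuallyRational fun t => b t i)
    (i : n) : EventuallyRational fun t => ((M t)⁻¹.mulVec (b t)) i := by
  refine sum _ fun j _ => EventuallyRational.mul ?_ (hb j)
  simp_rw [Matrix.inv_def, Matrix.smul_apply, Matrix.adjugate_apply, smul_eq_mul, Ring.inverse_eq_inv]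
  refine (det hM).inv.mul (det fun k m => ?_)
  simp_rw [Matrix.updateRow_apply]
  split_ifs
  · exact const _
  · exact hM k m

theorem exists_eventually_sign_eq (hf : EventuallyRational f) :
    ∃ c : SignType, ∀ᶠ t in 𝓝[<] (1 : ℝ), SignType.sign (f t) = c := by
  obtain ⟨p, q, -, hpq⟩ := hf
  obtain ⟨c, hc⟩ := p.exists_eventually_sign_eq 1
  obtain ⟨d, hd⟩ := q.exists_eventually_sign_eq 1
  refine ⟨c * d, ?_⟩
  filter_upwards [hpq, hc, hd] with t h1 h2 h3
  rw [h1, div_eq_mul_inv, sign_mul, h2, ← h3]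
  congr 1
  rcases lt_trichotomy (q.eval t) 0 with h | h | h
  · rw [sign_neg h, sign_neg (inv_lt_zero.2 h)]
  · simp [h]
  · rw [sign_pos h, sign_pos (inv_pos.2 h)]

end EventuallyRational

namespace Arena

variable {S A : Type*} {G : Arena S A}

/-- The strategy that chooses the action `f s` whenever the current state is `s`. -/
noncomputable def Strategy.ofPolicy (i : Player) (f : S → A) (hf : ∀ s, f s ∈ G.avail s) :
    G.Strategy i where
  toFun _ s := PMF.pure (f s)
  support_subset _ s := by simpa using hf s

theorem choice_of_owner_max {σ : G.Strategy .max} {τ : G.Strategy .min} {s : S}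
    (h : G.owner s = .max) (p : List (Stage S A)) : G.choice σ τ p s = σ.toFun p ⟨s, h⟩ := by
  unfold choice
  split
  · rfl
  · next h' => cases h.symm.trans h'

theorem choice_of_owner_min {σ : G.Strategy .max} {τ : G.Strategy .min} {s : S}
    (h : G.owner s = .min) (p : List (Stage S A)) : G.choice σ τ p s = τ.toFun p ⟨s, h⟩ := by
  unfold choice
  split
  · next h' => cases h.symm.trans h'
  · rfl

/-- The strategy chooses only actions for which the one-shot game with terminal payoff `v` has
payoff `v`. -/
def Strategy.Conserving {i : Player} (σ : G.Strategy i) (l r v : S → ℝ) : Prop :=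
  ∀ p s, ∀ a ∈ (σ.toFun p s).support, G.oneStep l r v s a = v s

/-- The policy `f` satisfies the optimality equations of the discounted game, with value
vector `v`. -/
structure IsOptimalPolicy (G : Arena S A) (l r : S → ℝ) (f : S → A) (v : S → ℝ) : Prop where
  mem_avail : ∀ s, f s ∈ G.avail s
  oneStep_eq : ∀ s, G.oneStep l r v s (f s) = v s
  oneStep_le : ∀ s, G.owner s = .max → ∀ a ∈ G.avail s, G.oneStep l r v s a ≤ v s
  le_oneStep : ∀ s, G.owner s = .min → ∀ a ∈ G.avail s, v s ≤ G.oneStep l r v s a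

namespace IsOptimalPolicy

variable {l r : S → ℝ} {f : S → A} {v : S → ℝ} {σ : G.Strategy .max} {τ : G.Strategy .min}

theorem nonempty_strategy (hv : G.IsOptimalPolicy l r f v) (i : Player) :
    Nonempty (G.Strategy i) :=
  ⟨.ofPolicy i f hv.mem_avail⟩

theorem conserving_ofPolicy (hv : G.IsOptimalPolicy l r f v) (i : Player) :
    (Strategy.ofPolicy i f hv.mem_avail).Conserving l r v := by
  intro p s a ha
  obtain rfl : a = f s := by simpa [Strategy.ofPolicy] using ha
  exact hv.oneStep_eq s

theorem le_oneStep_of_conserving (hv : G.IsOptimalPolicy l r f v) (hσ : σ.Conserving l r v)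
    (p : List (Stage S A)) (s : S) :
    ∀ a ∈ (G.choice σ τ p s).support, v s ≤ G.oneStep l r v s a := by
  intro a ha
  cases hs : G.owner s with
  | max =>
    rw [choice_of_owner_max hs] at ha
    exact (hσ p ⟨s, hs⟩ a ha).ge
  | min =>
    rw [choice_of_owner_min hs] at ha
    exact hv.le_oneStep s hs a (τ.support_subset _ _ ha)

theorem oneStep_le_of_conserving (hv : G.IsOptimalPolicy l r f v) (hτ : τ.Conserving l r v)
    (p : List (Stage S A)) (s : S) :
    ∀ a ∈ (G.choice σ τ p s).support, G.oneStep l r v s a ≤ v s := by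
  intro a ha
  cases hs : G.owner s with
  | max =>
    rw [choice_of_owner_max hs] at ha
    exact hv.oneStep_le s hs a (σ.support_subset _ _ ha)
  | min =>
    rw [choice_of_owner_min hs] at ha
    exact (hτ p ⟨s, hs⟩ a ha).le

end IsOptimalPolicy

section Finite

variable [Finite S] {l r : S → ℝ}

theorem oneStep_le_oneStep_add [Fintype S] {c : ℝ} (hl : ∀ s, l s ∈ Ico (0 : ℝ) 1)
    (hc : ∀ s, l s ≤ c) (v w : S → ℝ) (s : S) (a : A) :
    G.oneStep l r v s a ≤ G.oneStep l r w s a + c * dist v w := by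
  have h : (G.trans s a).mean v - (G.trans s a).mean w ≤ dist v w := by
    rw [← PMF.mean_sub]
    exact PMF.mean_le fun s' _ => (le_abs_self _).trans (dist_le_pi_dist v w s')
  have h1 := mul_le_mul_of_nonneg_left h (hl s).1
  have h2 := mul_le_mul_of_nonneg_right (hc s) (dist_nonneg (x := v) (y := w))
  simp only [oneStep]
  linarith

variable [Finite A]

theorem exists_isOptimalPolicy (G : Arena S A) (r : S → ℝ) (hl : ∀ s, l s ∈ Ico (0 : ℝ) 1) :
    ∃ f v, G.IsOptimalPolicy l r f v := by
  cases nonempty_fintype S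
  obtain ⟨c, hc0, hc1, hc⟩ := exists_lt_one_forall_le hl
  have hbest : ∀ (v : S → ℝ) (s : S), ∃ a ∈ G.avail s,
      (G.owner s = .max → ∀ b ∈ G.avail s, G.oneStep l r v s b ≤ G.oneStep l r v s a) ∧
      (G.owner s = .min → ∀ b ∈ G.avail s, G.oneStep l r v s a ≤ G.oneStep l r v s b) := by
    intro v s
    cases hs : G.owner s with
    | max =>
      obtain ⟨a, ha, h⟩ := (G.avail s).toFinite.exists_maximalFor (G.oneStep l r v s) _
        (G.avail_nonempty s)
      exact ⟨a, ha, fun _ b hb => (le_total _ _).elim id fun h' => h hb h', by simp⟩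
    | min =>
      obtain ⟨a, ha, h⟩ := (G.avail s).toFinite.exists_minimalFor (G.oneStep l r v s) _
        (G.avail_nonempty s)
      exact ⟨a, ha, by simp, fun _ b hb => (le_total _ _).elim id fun h' => h hb h'⟩
  choose best hmem hmax hmin using hbest
  let B : (S → ℝ) → S → ℝ := fun v s => G.oneStep l r v s (best v s)
  have hB : ∀ v w s, B v s ≤ B w s + c * dist v w := by
    intro v w s
    cases hs : G.owner s with
    | max =>
      exact (oneStep_le_oneStep_add hl hc v w s _).trans
        (add_le_add_left (hmax w s hs _ (hmem v s)) _)
    | min =>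
      exact (hmin v s hs _ (hmem w s)).trans (oneStep_le_oneStep_add hl hc v w s _)
  have hcontr : ContractingWith ⟨c, hc0⟩ B := by
    refine ⟨hc1, LipschitzWith.of_dist_le_mul fun v w => ?_⟩
    refine (dist_pi_le_iff (mul_nonneg hc0 dist_nonneg)).2 fun s => ?_
    rw [Real.dist_eq, abs_sub_le_iff]
    have h1 := hB v w s
    have h2 := hB w v s
    rw [dist_comm w v] at h2
    constructor <;> linarith
  set v := ContractingWith.fixedPoint B hcontr
  have hv (s : S) : G.oneStep l r v s (best v s) = v s := congrFun hcontr.fixedPoint_isFixedPt s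
  exact ⟨best v, v, hmem v, hv, fun s hs a ha => (hmax v s hs a ha).trans_eq (hv s),
    fun s hs a ha => (hv s).symm.trans_le (hmin v s hs a ha)⟩

theorem iInf_expect_le (hl : ∀ s, l s ∈ Ico (0 : ℝ) 1)
    (σ : G.Strategy .max) (τ : G.Strategy .min) (s : S) :
    ⨅ τ : G.Strategy .min, G.expect (discountedPayoff l r) σ τ s ≤
      G.expect (discountedPayoff l r) σ τ s := by
  obtain ⟨K, hK⟩ := exists_forall_abs_expect_le (G := G) (r := r) hl
  exact ciInf_le ⟨-K, by rintro _ ⟨τ, rfl⟩; exact (abs_le.1 (hK σ τ s)).1⟩ τ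

theorem le_iSup_expect (hl : ∀ s, l s ∈ Ico (0 : ℝ) 1)
    (σ : G.Strategy .max) (τ : G.Strategy .min) (s : S) :
    G.expect (discountedPayoff l r) σ τ s ≤
      ⨆ σ : G.Strategy .max, G.expect (discountedPayoff l r) σ τ s := by
  obtain ⟨K, hK⟩ := exists_forall_abs_expect_le (G := G) (r := r) hl
  exact le_ciSup (f := fun σ => G.expect (discountedPayoff l r) σ τ s)
    ⟨K, by rintro _ ⟨σ, rfl⟩; exact (abs_le.1 (hK σ τ s)).2⟩ σ

namespace IsOptimalPolicy

variable {f : S → A} {v : S → ℝ} {σ : G.Strategy .max} {τ : G.Strategy .min}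

theorem mean_le_expect (hv : G.IsOptimalPolicy l r f v) (hl : ∀ s, l s ∈ Ico (0 : ℝ) 1)
    (hσ : σ.Conserving l r v) (s : S) :
    (G.choice σ τ [] s).mean (G.oneStep l r v s) ≤ G.expect (discountedPayoff l r) σ τ s :=
  mean_oneStep_le_expect hl (fun p s => PMF.le_mean (hv.le_oneStep_of_conserving hσ p s)) s

theorem expect_le_mean (hv : G.IsOptimalPolicy l r f v) (hl : ∀ s, l s ∈ Ico (0 : ℝ) 1)
    (hτ : τ.Conserving l r v) (s : S) :
    G.expect (discountedPayoff l r) σ τ s ≤ (G.choice σ τ [] s).mean (G.oneStep l r v s) :=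
  expect_le_mean_oneStep hl (fun p s => PMF.mean_le (hv.oneStep_le_of_conserving hτ p s)) s

theorem le_expect (hv : G.IsOptimalPolicy l r f v) (hl : ∀ s, l s ∈ Ico (0 : ℝ) 1)
    (hσ : σ.Conserving l r v) (s : S) : v s ≤ G.expect (discountedPayoff l r) σ τ s :=
  (PMF.le_mean (hv.le_oneStep_of_conserving hσ [] s)).trans (hv.mean_le_expect hl hσ s)

theorem expect_le (hv : G.IsOptimalPolicy l r f v) (hl : ∀ s, l s ∈ Ico (0 : ℝ) 1)
    (hτ : τ.Conserving l r v) (s : S) : G.expect (discountedPayoff l r) σ τ s ≤ v s :=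
  (hv.expect_le_mean hl hτ s).trans (PMF.mean_le (hv.oneStep_le_of_conserving hτ [] s))

theorem iInf_expect_eq (hv : G.IsOptimalPolicy l r f v) (hl : ∀ s, l s ∈ Ico (0 : ℝ) 1)
    (hσ : σ.Conserving l r v) (s : S) :
    ⨅ τ : G.Strategy .min, G.expect (discountedPayoff l r) σ τ s = v s :=
  have := hv.nonempty_strategy .min
  le_antisymm ((iInf_expect_le hl _ _ s).trans (hv.expect_le hl (hv.conserving_ofPolicy _) s))
    (le_ciInf fun _ => hv.le_expect hl hσ s)

theorem iSup_expect_eq (hv : G.IsOptimalPolicy l r f v) (hl : ∀ s, l s ∈ Ico (0 : ℝ) 1)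
    (hτ : τ.Conserving l r v) (s : S) :
    ⨆ σ : G.Strategy .max, G.expect (discountedPayoff l r) σ τ s = v s :=
  have := hv.nonempty_strategy .max
  le_antisymm (ciSup_le fun _ => hv.expect_le hl hτ s)
    ((hv.le_expect hl (hv.conserving_ofPolicy _) s).trans (le_iSup_expect hl _ _ s))

theorem hasValue (hv : G.IsOptimalPolicy l r f v) (hl : ∀ s, l s ∈ Ico (0 : ℝ) 1) (s : S) :
    G.HasValue (discountedPayoff l r) s (v s) := by
  have hmax (σ : G.Strategy .max) : ⨅ τ : G.Strategy .min,
      G.expect (discountedPayoff l r) σ τ s ≤ v s :=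
    (iInf_expect_le hl _ _ s).trans (hv.expect_le hl (hv.conserving_ofPolicy _) s)
  have hmin (τ : G.Strategy .min) : v s ≤ ⨆ σ : G.Strategy .max,
      G.expect (discountedPayoff l r) σ τ s :=
    (hv.le_expect hl (hv.conserving_ofPolicy _) s).trans (le_iSup_expect hl _ _ s)
  have := hv.nonempty_strategy .max
  have := hv.nonempty_strategy .min
  refine ⟨le_antisymm (ciSup_le hmax) ?_, le_antisymm ?_ (le_ciInf hmin)⟩
  · exact (hv.iInf_expect_eq hl (hv.conserving_ofPolicy _) s).ge.trans
      (le_ciSup ⟨v s, by rintro _ ⟨σ, rfl⟩; exact hmax σ⟩ _)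
  · exact (ciInf_le ⟨v s, by rintro _ ⟨τ, rfl⟩; exact hmin τ⟩ _).trans
      (hv.iSup_expect_eq hl (hv.conserving_ofPolicy _) s).le

/-- A memoryless strategy of `max` is optimal if and only if it is conserving. -/
theorem optimalMax_iff (hv : G.IsOptimalPolicy l r f v) (hl : ∀ s, l s ∈ Ico (0 : ℝ) 1)
    (hσ : σ.Memoryless) : G.OptimalMax (discountedPayoff l r) σ ↔ σ.Conserving l r v := by
  refine ⟨fun h p s a ha => ?_, fun h s => ?_⟩
  · rw [hσ p s] at ha
    have hτ := hv.conserving_ofPolicy .min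
    have hs := (h s).symm.trans_le (iInf_expect_le hl σ (.ofPolicy .min f hv.mem_avail) s)
    rw [(hv.hasValue hl s).1] at hs
    refine PMF.eq_of_le_of_le_mean (hv.oneStep_le_of_conserving (σ := σ) hτ [] s)
      (hs.trans (hv.expect_le_mean hl hτ s)) ?_
    rwa [choice_of_owner_max s.2]
  · rw [hv.iInf_expect_eq hl h, (hv.hasValue hl s).1]

/-- A memoryless strategy of `min` is optimal if and only if it is conserving. -/
theorem optimalMin_iff (hv : G.IsOptimalPolicy l r f v) (hl : ∀ s, l s ∈ Ico (0 : ℝ) 1)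
    (hτ : τ.Memoryless) : G.OptimalMin (discountedPayoff l r) τ ↔ τ.Conserving l r v := by
  refine ⟨fun h p s a ha => ?_, fun h s => ?_⟩
  · rw [hτ p s] at ha
    have hσ := hv.conserving_ofPolicy .max
    have hs := (le_iSup_expect hl (.ofPolicy .max f hv.mem_avail) τ s).trans_eq (h s)
    rw [(hv.hasValue hl s).2] at hs
    refine PMF.eq_of_ge_of_mean_le (hv.le_oneStep_of_conserving (τ := τ) hσ [] s)
      ((hv.mean_le_expect hl hσ s).trans hs) ?_
    rwa [choice_of_owner_min s.2]
  · rw [hv.iSup_expect_eq hl h, (hv.hasValue hl s).2]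

end IsOptimalPolicy

end Finite

section PolicyValue

variable [Fintype S] [DecidableEq S] {l r : S → ℝ} {f : S → A} {v : S → ℝ}

/-- The matrix `I - ΛP` where `Λ` is the diagonal matrix of the discount factors and `P` is the
transition matrix of the policy `f`. -/
noncomputable def discountMatrix (G : Arena S A) (l : S → ℝ) (f : S → A) : Matrix S S ℝ :=
  fun s s' => (1 : Matrix S S ℝ) s s' - l s * (G.trans s (f s) s').toReal

/-- The expected discounted payoffs under the policy `f`. -/
noncomputable def policyValue (G : Arena S A) (l r : S → ℝ) (f : S → A) : S → ℝ :=
  (G.discountMatrix l f)⁻¹.mulVec fun s => (1 - l s) * r s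

theorem det_discountMatrix_ne_zero (G : Arena S A) (hl : ∀ s, l s ∈ Ico (0 : ℝ) 1) (f : S → A) :
    (G.discountMatrix l f).det ≠ 0 := by
  refine det_ne_zero_of_sum_row_lt_diag fun s => ?_
  obtain ⟨h0, h1⟩ := hl s
  have hsum : ∑ s' ∈ Finset.univ.erase s, ‖G.discountMatrix l f s s'‖ =
      l s * (1 - (G.trans s (f s) s).toReal) := by
    rw [← (G.trans s (f s)).sum_toReal, ← Finset.sum_erase_eq_sub (Finset.mem_univ s),
      Finset.mul_sum]
    refine Finset.sum_congr rfl fun s' hs' => ?_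
    rw [discountMatrix, Matrix.one_apply_ne (Finset.ne_of_mem_erase hs').symm, zero_sub, norm_neg,
      Real.norm_of_nonneg (mul_nonneg h0 ENNReal.toReal_nonneg)]
  rw [hsum, discountMatrix, Matrix.one_apply_eq]
  refine lt_of_lt_of_le ?_ (le_abs_self _)
  linarith

theorem mulVec_discountMatrix (G : Arena S A) (l : S → ℝ) (f : S → A) (v : S → ℝ) (s : S) :
    (G.discountMatrix l f).mulVec v s = v s - l s * (G.trans s (f s)).mean v := by
  simp only [Matrix.mulVec, dotProduct, discountMatrix, sub_mul, Finset.sum_sub_distrib,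
    Matrix.one_apply, ite_mul, one_mul, zero_mul, Finset.sum_ite_eq, Finset.mem_univ, if_true,
    PMF.mean_eq_sum, Finset.mul_sum, mul_assoc]

theorem oneStep_eq_iff_eq_policyValue (hl : ∀ s, l s ∈ Ico (0 : ℝ) 1) :
    (∀ s, G.oneStep l r v s (f s) = v s) ↔ v = G.policyValue l r f := by
  have hdet : IsUnit (G.discountMatrix l f).det := (G.det_discountMatrix_ne_zero hl f).isUnit
  trans (G.discountMatrix l f).mulVec v = fun s => (1 - l s) * r s
  · simp only [funext_iff, mulVec_discountMatrix, oneStep]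
    exact forall_congr' fun s => ⟨fun h => by linarith, fun h => by linarith⟩
  · refine ⟨fun h => ?_, fun h => ?_⟩
    · rw [policyValue, ← h, Matrix.mulVec_mulVec, Matrix.nonsing_inv_mul _ hdet, Matrix.one_mulVec]
    · rw [h, policyValue, Matrix.mulVec_mulVec, Matrix.mul_nonsing_inv _ hdet, Matrix.one_mulVec]

theorem IsOptimalPolicy.eq_policyValue (hv : G.IsOptimalPolicy l r f v)
    (hl : ∀ s, l s ∈ Ico (0 : ℝ) 1) : v = G.policyValue l r f :=
  (oneStep_eq_iff_eq_policyValue hl).1 hv.oneStep_eq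

end PolicyValue

end Arena

namespace IsRationalDiscountParam

variable {S A : Type*} {l : ℝ → S → ℝ}

theorem eventuallyRational (hl : IsRationalDiscountParam l) (s : S) :
    EventuallyRational fun t => l t s := by
  obtain ⟨p, q, hq, h⟩ := hl.rational s
  exact ⟨p, q, hq, (Polynomial.eventually_eval_ne_zero hq 1).mono h⟩

theorem eventually_mem_Ico (hl : IsRationalDiscountParam l) (s : S) :
    ∀ᶠ t in 𝓝[<] (1 : ℝ), l t s ∈ Ico (0 : ℝ) 1 := by
  obtain ⟨ε, h0, -, h⟩ := hl.mem_Ico s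
  filter_upwards [Ico_mem_nhdsLT (by linarith : 1 - ε < 1)] with t ht using h t ht

variable [Fintype S] [DecidableEq S]

theorem eventuallyRational_policyValue (hl : IsRationalDiscountParam l) (G : Arena S A)
    (r : S → ℝ) (f : S → A) (s : S) : EventuallyRational fun t => G.policyValue (l t) r f s :=
  .inv_mulVec
    (fun s _ => (EventuallyRational.const _).sub ((hl.eventuallyRational s).mul (.const _)))
    (fun s => ((EventuallyRational.const 1).sub (hl.eventuallyRational s)).mul (.const _)) s

theorem eventuallyRational_oneStep_policyValue (hl : IsRationalDiscountParam l) (G : Arena S A)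
    (r : S → ℝ) (f : S → A) (s : S) (a : A) :
    EventuallyRational fun t => G.oneStep (l t) r (G.policyValue (l t) r f) s a := by
  simp only [Arena.oneStep, PMF.mean_eq_sum]
  exact (((EventuallyRational.const 1).sub (hl.eventuallyRational s)).mul (.const _)).add
    ((hl.eventuallyRational s).mul <| .sum _ fun _ _ =>
      (EventuallyRational.const _).mul (hl.eventuallyRational_policyValue G r f _))

end IsRationalDiscountParam

theorem Filter.Eventually.exists_forall_mem_Ioo_one_sub {P : ℝ → Prop}
    (h : ∀ᶠ t in 𝓝[<] (1 : ℝ), P t) : ∃ ε : ℝ, 0 < ε ∧ ε < 1 ∧ ∀ t ∈ Ioo (1 - ε) 1, P t := by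
  obtain ⟨a, ha, hP⟩ := (mem_nhdsLT_iff_exists_mem_Ico_Ioo_subset (one_half_lt_one (α := ℝ))).1 h
  exact ⟨1 - a, sub_pos.2 ha.2, by linarith [ha.1], fun t ht => hP (by simpa using ht)⟩

theorem theorem2 {S A : Type*} [Finite S] [Finite A] (G : Arena S A) (r : S → ℝ)
    (l : ℝ → S → ℝ) (hl : IsRationalDiscountParam l) :
    ∃ ε : ℝ, 0 < ε ∧ ε < 1 ∧
      (∀ t ∈ Ioo (1 - ε) 1, ∀ s, l t s ∈ Ico (0 : ℝ) 1) ∧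
      (∀ s, ∃ p q : Polynomial ℝ, ∀ t ∈ Ioo (1 - ε) 1, q.eval t ≠ 0 ∧
        G.HasValue (discountedPayoff (l t) r) s (p.eval t / q.eval t)) ∧
      (∀ σ : G.Strategy .max, σ.Deterministic → σ.Memoryless →
        (∃ t ∈ Ioo (1 - ε) 1, G.OptimalMax (discountedPayoff (l t) r) σ) →
        ∀ t ∈ Ioo (1 - ε) 1, G.OptimalMax (discountedPayoff (l t) r) σ) ∧
      (∀ τ : G.Strategy .min, τ.Deterministic → τ.Memoryless →
        (∃ t ∈ Ioo (1 - ε) 1, G.OptimalMin (discountedPayoff (l t) r) τ) →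
        ∀ t ∈ Ioo (1 - ε) 1, G.OptimalMin (discountedPayoff (l t) r) τ) := by
  classical
  cases nonempty_fintype S
  choose p q hq hpq using fun f s => hl.eventuallyRational_policyValue G r f s
  choose c hc using fun f s a => ((hl.eventuallyRational_policyValue G r f s).sub
    (hl.eventuallyRational_oneStep_policyValue G r f s a)).exists_eventually_sign_eq
  obtain ⟨ε, h0, h1, h⟩ := ((eventually_all.2 hl.eventually_mem_Ico).and <|
    (eventually_all.2 fun f => eventually_all.2 fun s =>
      ((Polynomial.eventually_eval_ne_zero (hq f s) 1).and (hpq f s))).and <|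
    eventually_all.2 fun f => eventually_all.2 fun s => eventually_all.2 (hc f s)
    ).exists_forall_mem_Ioo_one_sub
  choose hIco hval hsign using h
  obtain ⟨f, v, hv⟩ := G.exists_isOptimalPolicy r (hIco (1 - ε / 2) ⟨by linarith, by linarith⟩)
  have hsame : ∀ t ∈ Ioo (1 - ε) 1, ∀ t' ∈ Ioo (1 - ε) 1, ∀ s a,
      SignType.sign (G.policyValue (l t) r f s - G.oneStep (l t) r (G.policyValue (l t) r f) s a) =
      SignType.sign
        (G.policyValue (l t') r f s - G.oneStep (l t') r (G.policyValue (l t') r f) s a) :=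
    fun t ht t' ht' s a => (hsign t ht f s a).trans (hsign t' ht' f s a).symm
  have hopt : ∀ t ∈ Ioo (1 - ε) 1, G.IsOptimalPolicy (l t) r f (G.policyValue (l t) r f) := by
    intro t ht
    have ht' : 1 - ε / 2 ∈ Ioo (1 - ε) 1 := ⟨by linarith, by linarith⟩
    obtain rfl := hv.eq_policyValue (hIco _ ht')
    refine ⟨hv.mem_avail, (Arena.oneStep_eq_iff_eq_policyValue (hIco t ht)).2 rfl,
      fun s hs a ha => ?_, fun s hs a ha => ?_⟩
    · rw [← sub_nonneg, ← sign_nonneg_iff, hsame t ht _ ht', sign_nonneg_iff, sub_nonneg]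
      exact hv.oneStep_le s hs a ha
    · rw [← sub_nonpos, ← sign_nonpos_iff, hsame t ht _ ht', sign_nonpos_iff, sub_nonpos]
      exact hv.le_oneStep s hs a ha
  have hcons : ∀ (i : Player) (σ : G.Strategy i), ∀ t ∈ Ioo (1 - ε) 1, ∀ t' ∈ Ioo (1 - ε) 1,
      σ.Conserving (l t) r (G.policyValue (l t) r f) →
      σ.Conserving (l t') r (G.policyValue (l t') r f) := by
    intro i σ t ht t' ht' h p s a ha
    have := h p s a ha
    rw [eq_comm, ← sub_eq_zero, ← sign_eq_zero_iff] at this ⊢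
    rwa [hsame t' ht' t ht]
  refine ⟨ε, h0, h1, hIco, fun s => ⟨p f s, q f s, fun t ht => ⟨(hval t ht f s).1, ?_⟩⟩,
    fun σ _ hσ ⟨t, ht, h⟩ t' ht' => ?_, fun τ _ hτ ⟨t, ht, h⟩ t' ht' => ?_⟩
  · rw [← (hval t ht f s).2]
    exact (hopt t ht).hasValue (hIco t ht) s
  · rw [(hopt t ht).optimalMax_iff (hIco t ht) hσ] at h
    exact ((hopt t' ht').optimalMax_iff (hIco t' ht') hσ).2 (hcons _ σ t ht t' ht' h)
  · rw [(hopt t ht).optimalMin_iff (hIco t ht) hτ] at h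
    exact ((hopt t' ht').optimalMin_iff (hIco t' ht') hτ).2 (hcons _ τ t ht t' ht' h)
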